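/- Let $0\le N\le L$ be integers, and let $\hat a_r^\dagger,\hat a_r$ ($1\le r\le L$) be the fermionic creation and annihilation operators on the Fock space of $L$ orthonormal spin-orbitals $\varphi_1,\dots,\varphi_L$. Let $\Psi_0$ be the Fermi vacuum, i.e. the Slater determinant of $\varphi_1,\dots,\varphi_N$. Its occupation numbers are $n_r=1$ for $r\le N$ (occupied) and $n_r=0$ for $r>N$ (virtual). An operator pointing at an occupied (virtual) spin-orbital is called an o-operator (v-operator). Chains. Let $\hat C$ be a finite product of deexcitation operators $\hat a_i^\dagger\hat a_a$ and excitation operators $\hat a_b^\dagger\hat a_j$ ($i,j\le N<a,b$), in any order, and of at most one further pair $\hat a_r^\dagger\hat a_s$ with arbitrary $r,s\in\{1,\dots,L\}$. Fix a full contraction of $\hat C$, i.e. a partition of its operators into contracted pairs. The contraction of two operators $x,y$ (in that order) is $xy-\{xy\}$, where $\{xy\}$ is the normal-ordered product relative to $\Psi_0$: $\{xy\}=-yx$ if $x$ is an o-creation or v-annihilation operator and $y$ is an o-annihilation or v-creation operator, and $\{xy\}=xy$ otherwise. The expectation value $\langle\hat C\rangle_{\Psi_0}$ of the fully contracted chain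 is obtained by removing the contracted pairs one after another, in any order. A pair $x,y$ with $n$ remaining operators between $x$ and $y$ contributes the factor $(-1)^n$ times the $\Psi_0$-expectation value of the contraction of $x$ and $y$; the empty chain has the value $1$. Diagrams. The diagram $D$ of the contracted chain consists of symbols placed from left to right on a horizontal line: an opening bracket for each deexcitation operator, a closing bracket for each excitation operator, and a dash for the arbitrary pair. The upper extremity of a bracket is annotated with its o-operator, the lower one with its v-operator; the extremities of opening (closing) brackets point to the right (left). The left extremity of the dash is annotated with $\hat a_r^\dagger$, the right one with $\hat a_s$; each is bent toward the upper or the lower half-plane and points to the left or to the right. Two extremities are connected if and only if their operators are contracted; a connection between extremities of the same half-plane is drawn as a semicircle in that half-plane, bulging away from the horizontal line. A crossing is a (non-tangential) contact point of two connection lines. The diagram, and with it the contracted chain, is well-formed if - (P1) the two extremities of each connection are in the same half-plane; - (P2) the left extremity of each connection points to the right and the right one to the left; - (P3) the (left, right) extremities of the dash, if there is one, are bent in one of the four ways: (up pointing right, up pointing left), (up pointing right, down pointing right), (down pointing left, up pointing left), (down pointing left, down pointing right). Statement. Let $\hat C$ be a well-formed fully contracted chain, $D$ its well-formed diagram, and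 $\mathcal N$ the number of crossings in $D$. A connection between extremities whose operators point at $\varphi_p$ and $\varphi_q$ reads $\delta_{p,q}$. Then $\langle\hat C\rangle_{\Psi_0}$ is well defined, i.e. independent of the order in which the contracted pairs are removed, and $$\langle\hat C\rangle_{\Psi_0}=(-1)^{\mathcal N}\,\Big(\prod_{\text{connections } p - q}\delta_{p,q}\Big)\,\omega ,$$ where $\omega=1$ if there is no dash, and otherwise $\omega$ is the product over the two extremities of the dash of $n_t$ (extremity bent up) or $1-n_t$ (extremity bent down), $\varphi_t$ being the spin-orbital at which the operator of the extremity points. Moreover, $$\langle\hat C\rangle_{\Psi_0}=(-1)^{\mathcal N}\prod_{\text{connections } p - q}\delta_{p,q}$$ unless the two extremities of the dash are connected to each other and $r$ is virtual. -/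

import Mathlib

/-! Fermionic Fock space over the spin-orbitals `0, …, L - 1`, of which the first `N` are occupied in
the Fermi vacuum; contractions relative to the Fermi vacuum; fully contracted chains of
(de)excitation operators and at most one arbitrary creation-annihilation pair; their diagrams. -/

namespace FermiDiagram

/-! ### Second quantization -/

/-- A second quantization operator: the creation or the annihilation operator pointing at a
spin-orbital. -/
inductive LadderOp (L : ℕ) where
  | cre (r : Fin L)
  | ann (r : Fin L)

/-- The spin-orbital a second quantization operator is pointing at. -/
def LadderOp.orbital {L : ℕ} : LadderOp L → Fin L
  | .cre r => r
  | .ann r => r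

/-- Operators on the Fock space of `L` spin-orbitals, as matrices in the orthonormal basis of the
Slater determinants; a determinant is given by the set of the spin-orbitals it contains. -/
abbrev FockOp (L : ℕ) := Matrix (Finset (Fin L)) (Finset (Fin L)) ℂ

/-- The annihilation operator: it maps the determinant `T` to
`(-1) ^ #{t ∈ T | t < r}` times the determinant `T \ {r}` if `r ∈ T`, and to `0` otherwise. -/
noncomputable def annihilation {L : ℕ} (r : Fin L) : FockOp L :=
  Matrix.of fun S T =>
    if r ∈ T ∧ S = T.erase r then (-1) ^ (T.filter (· < r)).card else 0

/-- The creation operator is the adjoint of the annihilation operator. -/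
noncomputable def creation {L : ℕ} (r : Fin L) : FockOp L :=
  (annihilation r).conjTranspose

/-- The operator on the Fock space. -/
noncomputable def LadderOp.toFock {L : ℕ} : LadderOp L → FockOp L
  | .cre r => creation r
  | .ann r => annihilation r

/-- The Fermi vacuum: the determinant of the first `N` spin-orbitals. -/
noncomputable def fermiVacuum (L N : ℕ) : Finset (Fin L) → ℂ :=
  Pi.single (Finset.univ.filter fun r : Fin L => r.val < N) 1

/-- The expectation value of an operator relatively to the Fermi vacuum. -/
noncomputable def expect {L : ℕ} (N : ℕ) (A : FockOp L) : ℂ :=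
  star (fermiVacuum L N) ⬝ᵥ A.mulVec (fermiVacuum L N)

/-- The occupation number of a spin-orbital in the Fermi vacuum. -/
noncomputable def occupation {L : ℕ} (N : ℕ) (r : Fin L) : ℂ :=
  if r.val < N then 1 else 0

/-- The operators that annihilate the Fermi vacuum: creation operators pointing at an occupied
spin-orbital and annihilation operators pointing at a virtual one. -/
def LadderOp.IsQuasiAnnihilation {L : ℕ} (N : ℕ) : LadderOp L → Prop
  | .cre r => r.val < N
  | .ann r => N ≤ r.val

open Classical in
/-- The normal-ordered product of two operators relatively to the Fermi vacuum. -/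
noncomputable def normalOrderedPair {L : ℕ} (N : ℕ) (x y : LadderOp L) : FockOp L :=
  if x.IsQuasiAnnihilation N ∧ ¬ y.IsQuasiAnnihilation N then - (y.toFock * x.toFock)
  else x.toFock * y.toFock

/-- The contraction of two operators (in that order) relatively to the Fermi vacuum. -/
noncomputable def contraction {L : ℕ} (N : ℕ) (x y : LadderOp L) : FockOp L :=
  x.toFock * y.toFock - normalOrderedPair N x y

/-! ### Chains and full contractions -/

/-- The occupied spin-orbitals. -/
abbrev Occ (L N : ℕ) := {r : Fin L // r.val < N}

/-- The virtual spin-orbitals. -/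
abbrev Virt (L N : ℕ) := {r : Fin L // N ≤ r.val}

/-- The elements of a chain: the deexcitation operator `o†_i v_a`, the excitation operator
`v†_b o_j`, and an arbitrary creation-annihilation pair `a†_r a_s`. -/
inductive Block (L N : ℕ) where
  | deexc (i : Occ L N) (a : Virt L N)
  | exc (b : Virt L N) (j : Occ L N)
  | pair (r s : Fin L)

/-- The left operator of a block. -/
def Block.first {L N : ℕ} : Block L N → LadderOp L
  | .deexc i _ => .cre i.val
  | .exc b _ => .cre b.val
  | .pair r _ => .cre r

/-- The right operator of a block. -/
def Block.second {L N : ℕ} : Block L N → LadderOp L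
  | .deexc _ a => .ann a.val
  | .exc _ j => .ann j.val
  | .pair _ s => .ann s

/-- The block is an arbitrary creation-annihilation pair. -/
def Block.IsPair {L N : ℕ} : Block L N → Prop
  | .pair _ _ => True
  | _ => False

/-- The positions of the `2 m` operators of a chain of `m` blocks, ordered from left to right:
`(k, 0)` and `(k, 1)` are the left and the right operator of block `k`. -/
abbrev Pos (m : ℕ) := Fin m ×ₗ Fin 2

/-- The position of the left operator of block `k`. -/
def leftPos {m : ℕ} (k : Fin m) : Pos m := toLex (k, 0)

/-- The position of the right operator of block `k`. -/
def rightPos {m : ℕ} (k : Fin m) : Pos m := toLex (k, 1)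

/-- The block to which a position belongs. -/
def Pos.block {m : ℕ} (p : Pos m) : Fin m := (ofLex p).1

/-- The operator of the chain at a given position. -/
def opAt {L N m : ℕ} (C : Fin m → Block L N) (p : Pos m) : LadderOp L :=
  if (ofLex p).2 = 0 then (C (Pos.block p)).first else (C (Pos.block p)).second

/-- The chain contains at most one arbitrary creation-annihilation pair. -/
def AtMostOnePair {L N m : ℕ} (C : Fin m → Block L N) : Prop :=
  ∀ k l, (C k).IsPair → (C l).IsPair → k = l

/-- A full contraction of a chain of `m` blocks: each operator is contracted with another one. -/
structure FullContraction (m : ℕ) where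
  partner : Pos m → Pos m
  partner_partner : ∀ p, partner (partner p) = p
  partner_ne : ∀ p, partner p ≠ p

/-- `ContractedValue C σ S v`: the operators of the chain `C` at the positions in `S`, contracted
according to `σ`, have the expectation value `v` relatively to the Fermi vacuum. A contracted pair
with `n` remaining operators in between may be taken out, whichever pair it is, at the price of
`(-1) ^ n` and of the expectation value of its contraction; the empty chain has the value `1`. -/
inductive ContractedValue {L N m : ℕ} (C : Fin m → Block L N) (σ : FullContraction m) :
    Finset (Pos m) → ℂ → Prop
  | empty : ContractedValue C σ ∅ 1
  | takeOut (S : Finset (Pos m)) (p q : Pos m) (v : ℂ) (hp : p ∈ S) (hq : q ∈ S) (hpq : p < q)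
      (hσ : σ.partner p = q) (h : ContractedValue C σ ((S.erase p).erase q) v) :
      ContractedValue C σ S
        ((-1) ^ (S.filter fun x => p < x ∧ x < q).card
          * expect N (contraction N (opAt C p) (opAt C q)) * v)

/-- The fully contracted chain has the expectation value `v` relatively to the Fermi vacuum. -/
def HasExpectation {L N m : ℕ} (C : Fin m → Block L N) (σ : FullContraction m) (v : ℂ) : Prop :=
  ContractedValue C σ Finset.univ v

/-! ### Diagrams -/

/-- The upper (occupied) and the lower (virtual) half-plane. -/
inductive HalfPlane where
  | upper
  | lower
  deriving DecidableEq

/-- The direction in which an extremity points. -/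
inductive Direction where
  | left
  | right
  deriving DecidableEq

/-- The fully connected diagram of a chain `C` with full contraction `σ`. A deexcitation operator
is drawn as an opening bracket, an excitation operator as a closing bracket, an arbitrary pair as a
dash. Each extremity is annotated with one operator and is indexed by the position of that operator;
the extremities at `p` and `σ.partner p` are connected. Bracket extremities have a prescribed
half-plane (upper for the o-operator, lower for the v-operator) and direction (right for opening,
left for closing brackets); each extremity of a dash may be bent toward any half-plane and in
any direction. -/
structure Diagram {L N m : ℕ} (C : Fin m → Block L N) (σ : FullContraction m) where
  half : Pos m → HalfPlane
  dir : Pos m → Direction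
  opening : ∀ k i a, C k = .deexc i a →
    half (leftPos k) = .upper ∧ half (rightPos k) = .lower ∧
    dir (leftPos k) = .right ∧ dir (rightPos k) = .right
  closing : ∀ k b j, C k = .exc b j →
    half (leftPos k) = .lower ∧ half (rightPos k) = .upper ∧
    dir (leftPos k) = .left ∧ dir (rightPos k) = .left

/-- The abscissa of the extremity annotated with the operator at position `p`. Both extremities of a
bracket have the same abscissa; the extremities of a dash are on the left and on the right of its
center. -/
noncomputable def abscissa {L N m : ℕ} (C : Fin m → Block L N) (p : Pos m) : ℝ :=
  match C (Pos.block p) with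
  | .pair _ _ => ((Pos.block p).val : ℝ) + (if (ofLex p).2 = 0 then -1 / 4 else 1 / 4)
  | _ => ((Pos.block p).val : ℝ)

/-- The ordinate of the extremities in a half-plane. -/
noncomputable def HalfPlane.ordinate : HalfPlane → ℝ
  | .upper => 1
  | .lower => -1

namespace Diagram

variable {L N m : ℕ} {C : Fin m → Block L N} {σ : FullContraction m}

/-- The line that connects the extremities at `p` and `σ.partner p`: if both are in the same
half-plane, the semicircle with these end points that bulges away from the imaginary line
separating the half-planes; otherwise the segment between them. -/
noncomputable def line (D : Diagram C σ) (p : Pos m) : Set (ℝ × ℝ) :=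
  let q := σ.partner p
  let y := (D.half p).ordinate
  if D.half p = D.half q then
    {z | 0 ≤ y * (z.2 - y) ∧
      (z.1 - abscissa C p) * (z.1 - abscissa C q) + (z.2 - y) ^ 2 = 0}
  else segment ℝ (abscissa C p, y) (abscissa C q, (D.half q).ordinate)

/-- The number of crossings: the contacts of the lines of two different connections, a connection
being given by the left one of its two positions. As different connections have different
end points, none of these contacts is tangential. -/
noncomputable def crossings (D : Diagram C σ) : ℕ :=
  ∑ p : Pos m with p < σ.partner p, ∑ q : Pos m with q < σ.partner q ∧ p < q,
    (D.line p ∩ D.line q).ncard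

/-- The product of the Kronecker deltas read from the connections. -/
noncomputable def deltas (_D : Diagram C σ) : ℂ :=
  ∏ p : Pos m with p < σ.partner p,
    if (opAt C p).orbital = (opAt C (σ.partner p)).orbital then 1 else 0

open Classical in
/-- The product, over the extremities of the dash (if any), of `n` if the extremity is bent toward
the upper half-plane and of `1 - n` if it is bent toward the lower one, where `n` is the occupation
number of the spin-orbital its operator is pointing at. -/
noncomputable def dashOccupation (D : Diagram C σ) : ℂ :=
  ∏ p : Pos m with (C (Pos.block p)).IsPair,
    if D.half p = .upper then occupation N (opAt C p).orbital
    else 1 - occupation N (opAt C p).orbital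

/-- A well-formed fully connected diagram. -/
structure WellFormed (D : Diagram C σ) : Prop where
  /-- The two extremities of a connection are in the same half-plane. -/
  P1 : ∀ p, D.half p = D.half (σ.partner p)
  /-- The left extremity of a connection points to the right, the right one to the left. -/
  P2 : ∀ p, abscissa C p < abscissa C (σ.partner p) →
    D.dir p = .right ∧ D.dir (σ.partner p) = .left
  /-- A dash is bent in one of the four ways top-top/right-left, top-bottom/right-right,
  bottom-top/left-left, bottom-bottom/left-right. -/
  P3 : ∀ k, (C k).IsPair →
    (D.half (leftPos k), D.half (rightPos k), D.dir (leftPos k), D.dir (rightPos k)) ∈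
      ({(.upper, .upper, .right, .left), (.upper, .lower, .right, .right),
        (.lower, .upper, .left, .left), (.lower, .lower, .left, .right)} :
        Set (HalfPlane × HalfPlane × Direction × Direction))

end Diagram

end FermiDiagram

open FermiDiagram

/-! Draw all contraction lines as chords on one side of the chain. Modulo 2, the number of remaining
operators inside a chord is the number of remaining chords crossing it, since a nested chord
contributes two end points. Removing pairs in any order therefore gives the sign of the total number
of chord crossings times the product of the contractions (`crossParity_eq_erase_chord`,
`contractedValue_iff`).

The diagram retains only crossings between chords in the same half-plane, so it remains to see that
the mixed ones are even in number. Modulo 2 they count the pairs of an upper extremity before a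
lower one (`sum_mixed_crossings`). By P2 as many extremities point right as left, which with the
bracket conventions and P3 makes the numbers of upper left and upper right operators equal; a count
by blocks then gives evenness (`even_upper_before_lower`, `crossParity_eq`).

For the factors, P1–P3 make an upper connection a creation-annihilation contraction, worth `δ n`,
and a lower one an annihilation-creation contraction, worth `δ (1 - n)`. Occupation factors are
idempotent and equal 1 at brackets, so only those of the dash survive (`contractionProd_eq`). A dash
extremity connected to a bracket inherits the factor 1 through the Kronecker delta, which leaves the
self-connected dash as the only possible exception (`weight_eq_one_of_deltas`). -/

namespace FermiDiagram

/-! ### Sums over the chords of a fixed-point-free involution -/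

section Chords

variable {α : Type*} [LinearOrder α]

/-- The sum of `f a b` over the pairs `a < b` of elements of `B`. -/
def pairSum {R : Type*} [AddCommMonoid R] (B : Finset α) (f : α → α → R) : R :=
  ∑ a ∈ B, ∑ b ∈ B, if a < b then f a b else 0

/-- Symmetry of `f` at `p` makes the place of `p` in the order irrelevant, so that any chord can be
split off, not only an extreme one. -/
lemma pairSum_insert {R : Type*} [AddCommMonoid R] {B : Finset α} {p : α} (hp : p ∉ B)
    {f : α → α → R} (hf : ∀ b ∈ B, f b p = f p b) :
    pairSum (insert p B) f = pairSum B f + ∑ b ∈ B, f p b := by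
  unfold pairSum
  rw [Finset.sum_insert hp, Finset.sum_insert hp,
    Finset.sum_congr rfl fun a _ => Finset.sum_insert hp, Finset.sum_add_distrib]
  simp only [lt_irrefl, if_false, zero_add]
  rw [← add_assoc, ← Finset.sum_add_distrib, add_comm]
  congr 1
  refine Finset.sum_congr rfl fun b hb => ?_
  rcases lt_trichotomy p b with h | h | h
  · simp [h, h.not_gt]
  · exact absurd (h ▸ hb) hp
  · simp [h, h.not_gt, hf b hb]

lemma pairSum_congr {R : Type*} [AddCommMonoid R] {B : Finset α} {f g : α → α → R}
    (h : ∀ a ∈ B, ∀ b ∈ B, a < b → f a b = g a b) : pairSum B f = pairSum B g := by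
  refine Finset.sum_congr rfl fun a ha => Finset.sum_congr rfl fun b hb => ?_
  split_ifs with hab
  · exact h a ha b hb hab
  · rfl

lemma pairSum_add {R : Type*} [AddCommMonoid R] (B : Finset α) (f g : α → α → R) :
    pairSum B (fun a b => f a b + g a b) = pairSum B f + pairSum B g := by
  unfold pairSum
  rw [← Finset.sum_add_distrib]
  refine Finset.sum_congr rfl fun a _ => ?_
  rw [← Finset.sum_add_distrib]
  refine Finset.sum_congr rfl fun b _ => ?_
  split_ifs <;> simp

/-- The pairs whose two members lie on different sides of a bipartition may be listed with the
member of the first side in front. -/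
lemma pairSum_bipartite {R : Type*} [AddCommMonoid R] (B : Finset α) (P : α → Prop)
    [DecidablePred P] {f : α → α → R} (hf : ∀ a ∈ B, ∀ b ∈ B, a ≠ b → f a b = f b a) :
    pairSum B (fun a b => if (P a ↔ P b) then 0 else f a b)
      = ∑ a ∈ B, ∑ b ∈ B, if ¬ P a ∧ P b then f a b else 0 := by
  have h1 : pairSum B (fun a b => if (P a ↔ P b) then 0 else f a b)
      = ∑ a ∈ B, ∑ b ∈ B, (if a < b ∧ ¬ P a ∧ P b then f a b else 0)
        + ∑ a ∈ B, ∑ b ∈ B, (if a < b ∧ P a ∧ ¬ P b then f a b else 0) := by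
    unfold pairSum
    simp only [← Finset.sum_add_distrib]
    refine Finset.sum_congr rfl fun a _ => Finset.sum_congr rfl fun b _ => ?_
    by_cases hab : a < b <;> by_cases ha : P a <;> by_cases hb : P b <;> simp [hab, ha, hb]
  rw [h1, Finset.sum_comm (s := B) (t := B) (f := fun a b => if a < b ∧ P a ∧ ¬ P b then _ else _)]
  simp only [← Finset.sum_add_distrib]
  refine Finset.sum_congr rfl fun a ha => Finset.sum_congr rfl fun b hb => ?_
  by_cases hPa : P a
  · simp [hPa]
  by_cases hPb : P b
  · have hne : a ≠ b := fun h => hPa (h ▸ hPb)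
    rcases hne.lt_or_gt with h | h
    · simp [hPa, hPb, h, h.not_gt]
    · simp [hPa, hPb, h, h.not_gt, hf a ha b hb hne]
  · simp [hPb]

variable {τ : α → α}

/-- A sum over a set that is stable under a fixed-point-free involution, listed by chords. -/
lemma sum_eq_sum_chords {R : Type*} [AddCommMonoid R] (hτ : ∀ p, τ (τ p) = p) (hne : ∀ p, τ p ≠ p)
    {S : Finset α} (hS : ∀ p ∈ S, τ p ∈ S) (g : α → R) :
    ∑ x ∈ S, g x = ∑ x ∈ S with x < τ x, (g x + g (τ x)) := by
  rw [Finset.sum_add_distrib, ← Finset.sum_filter_add_sum_filter_not S (fun x => x < τ x)]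
  congr 1
  refine Finset.sum_nbij' τ τ ?_ ?_ ?_ ?_ ?_
  · intro x hx
    simp only [Finset.mem_filter, not_lt] at hx ⊢
    exact ⟨hS x hx.1, by rw [hτ]; exact lt_of_le_of_ne hx.2 (hne x)⟩
  · intro x hx
    simp only [Finset.mem_filter, not_lt] at hx ⊢
    exact ⟨hS x hx.1, by rw [hτ]; exact hx.2.le⟩
  · intro x _; exact hτ x
  · intro x _; exact hτ x
  · intro x _; rw [hτ]

/-- The indicator, modulo 2, of the points strictly inside the chord `p — τ p`. -/
def inside (τ : α → α) (p x : α) : ZMod 2 := if p < x ∧ x < τ p then 1 else 0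

/-- The number, modulo 2, of end points of the chord `q — τ q` inside the chord `p — τ p`:
`1` if the chords cross and `0` otherwise. -/
def chordCross (τ : α → α) (p q : α) : ZMod 2 := inside τ p q + inside τ p (τ q)

lemma chordCross_self (p : α) : chordCross τ p p = 0 := by
  simp [chordCross, inside]

/-- Interleaving of two chords is a symmetric relation; the four end points are distinct, and each
of their possible orders is checked. -/
lemma chordCross_symm (hτ : ∀ p, τ (τ p) = p) {p q : α} (hp : p < τ p) (hq : q < τ q)
    (hpq : p ≠ q) : chordCross τ p q = chordCross τ q p := by
  have h1 : τ p ≠ q := by rintro rfl; rw [hτ] at hq; exact lt_asymm hp hq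
  have h2 : τ q ≠ p := by rintro rfl; rw [hτ] at hp; exact lt_asymm hp hq
  have h3 : τ p ≠ τ q := fun h => hpq (by rw [← hτ p, h, hτ])
  have h2' : (1 : ZMod 2) + 1 = 0 := rfl
  unfold chordCross inside
  rcases hpq.lt_or_gt with h4 | h4 <;> rcases h1.lt_or_gt with h5 | h5 <;>
    rcases h2.lt_or_gt with h6 | h6 <;> rcases h3.lt_or_gt with h7 | h7 <;>
    first
    | (exfalso; order)
    | simp [h4, h5, h6, h7, h4.not_gt, h5.not_gt, h6.not_gt, h7.not_gt, h2']

lemma sum_inside (hτ : ∀ p, τ (τ p) = p) (hne : ∀ p, τ p ≠ p) {S : Finset α}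
    (hS : ∀ p ∈ S, τ p ∈ S) (p : α) :
    ∑ x ∈ S, inside τ p x = ∑ q ∈ S with q < τ q, chordCross τ p q :=
  sum_eq_sum_chords hτ hne hS _

/-- The number of crossing pairs of chords in `S`, modulo 2. -/
def crossParity (τ : α → α) (S : Finset α) : ZMod 2 :=
  pairSum (S.filter fun p => p < τ p) (chordCross τ)

lemma filter_left_erase_chord (hτ : ∀ p, τ (τ p) = p) {S : Finset α} {p : α} (hp : p ∈ S)
    (hlt : p < τ p) :
    S.filter (fun x => x < τ x) =
      insert p (((S.erase p).erase (τ p)).filter fun x => x < τ x) := by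
  ext x
  simp only [Finset.mem_filter, Finset.mem_insert, Finset.mem_erase]
  constructor
  · rintro ⟨h1, h2⟩
    by_cases hx : x = p
    · exact Or.inl hx
    · refine Or.inr ⟨⟨?_, hx, h1⟩, h2⟩
      rintro rfl
      rw [hτ] at h2
      exact lt_asymm h2 hlt
  · rintro (rfl | h)
    · exact ⟨hp, hlt⟩
    · exact ⟨h.1.2.2, h.2⟩

lemma chord_erase_stable (hτ : ∀ p, τ (τ p) = p) {S : Finset α} (hS : ∀ p ∈ S, τ p ∈ S) (p : α) :
    ∀ x ∈ (S.erase p).erase (τ p), τ x ∈ (S.erase p).erase (τ p) := by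
  intro x hx
  simp only [Finset.mem_erase] at hx ⊢
  refine ⟨fun h => hx.2.1 ?_, fun h => hx.1 ?_, hS x hx.2.2⟩
  · rw [← hτ x, h, hτ]
  · rw [← hτ x, h]

/-- The crossings lost with a chord are those on it, and by `sum_inside` their parity is that of the
points it encloses. This is what makes the order of removal immaterial. -/
lemma crossParity_eq_erase_chord (hτ : ∀ p, τ (τ p) = p) (hne : ∀ p, τ p ≠ p) {S : Finset α}
    (hS : ∀ p ∈ S, τ p ∈ S) {p : α} (hp : p ∈ S) (hlt : p < τ p) :
    crossParity τ S = ∑ x ∈ S, inside τ p x + crossParity τ ((S.erase p).erase (τ p)) := by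
  have hnot : p ∉ ((S.erase p).erase (τ p)).filter fun x => x < τ x := by simp
  rw [sum_inside hτ hne hS, crossParity, filter_left_erase_chord hτ hp hlt,
    Finset.sum_insert hnot, chordCross_self, zero_add, pairSum_insert hnot, add_comm]
  · rfl
  · intro b hb
    have hb' := (Finset.mem_filter.1 hb).2
    exact chordCross_symm hτ hb' hlt (by rintro rfl; exact hnot hb)

/-- If `τ` respects a bipartition into the points with and without `P`, then the number of crossings
between a chord with and a chord without `P` is, modulo 2, the number of pairs `u < x` of a
point `u` with and a point `x` without `P`. -/
lemma sum_mixed_crossings [Fintype α] (hτ : ∀ p, τ (τ p) = p) (hne : ∀ p, τ p ≠ p) (P : α → Prop)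
    [DecidablePred P] (hP : ∀ p, P (τ p) ↔ P p) :
    (∑ p with p < τ p, ∑ q with q < τ q, if ¬ P p ∧ P q then chordCross τ p q else 0)
      = ∑ x, ∑ u, if ¬ P x ∧ P u ∧ u < x then (1 : ZMod 2) else 0 := by
  have h2 : (1 : ZMod 2) + 1 = 0 := rfl
  rw [sum_eq_sum_chords hτ hne (S := Finset.univ) (fun _ _ => Finset.mem_univ _)
    (fun x => ∑ u, if ¬ P x ∧ P u ∧ u < x then (1 : ZMod 2) else 0)]
  refine Finset.sum_congr rfl fun p hp => ?_
  have hlt := (Finset.mem_filter.1 hp).2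
  by_cases hPp : P p
  · simp [hPp, hP]
  have hS : ∀ x ∈ Finset.univ.filter P, τ x ∈ Finset.univ.filter P := by
    intro x hx
    simpa [hP] using hx
  have key := sum_inside hτ hne hS p
  rw [Finset.filter_comm, Finset.sum_filter (p := P), Finset.sum_filter (p := P)] at key
  simp only [hPp, not_false_eq_true, true_and, hP]
  -- For the chord `p — τ p`, a point `u` with `P` precedes both end points (counted twice, hence
  -- 0), only `τ p` (it is inside, counted once), or neither.
  rw [← key, ← Finset.sum_add_distrib]
  refine Finset.sum_congr rfl fun u _ => ?_
  by_cases hPu : P u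
  · have hup : u ≠ p := by rintro rfl; exact hPp hPu
    simp only [hPu, true_and, inside, if_true]
    rcases hup.lt_or_gt with h | h
    · simp [h, h.not_gt, h.trans hlt, h2]
    · simp [h, h.not_gt]
  · simp [hPu]

end Chords
end FermiDiagram

namespace FermiDiagram

/-! ### Contractions in the Fermi vacuum -/

lemma expect_eq {L : ℕ} (N : ℕ) (A : FockOp L) :
    expect N A = A (Finset.univ.filter fun r : Fin L => r.val < N)
      (Finset.univ.filter fun r : Fin L => r.val < N) := by
  have h : star (fermiVacuum L N) = fermiVacuum L N := by
    unfold fermiVacuum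
    rw [← Pi.single_star, star_one]
  unfold expect
  rw [h]
  unfold fermiVacuum
  rw [Matrix.mulVec_single_one, single_one_dotProduct]
  rfl

lemma expect_creation_mul_annihilation {L : ℕ} (N : ℕ) (r s : Fin L) :
    expect N (creation r * annihilation s) = if r = s ∧ r.val < N then 1 else 0 := by
  rw [expect_eq]
  set V := Finset.univ.filter fun r : Fin L => r.val < N with hV
  have hmem : ∀ t, t ∈ V ↔ t.val < N := by simp [hV]
  -- The only intermediate determinant that annihilation at `s` can reach from the vacuum.
  rw [Matrix.mul_apply, Finset.sum_eq_single (V.erase s)]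
  · simp only [creation, annihilation, Matrix.conjTranspose_apply, Matrix.of_apply, and_true]
    by_cases hrs : r = s
    · subst hrs
      by_cases hr : r.val < N
      · simp [hmem, hr, ← mul_pow]
      · simp [hmem, hr]
    · by_cases hs : s ∈ V
      · have : ¬ (r ∈ V ∧ V.erase s = V.erase r) := by
          rintro ⟨h1, h2⟩
          have : r ∈ V.erase s := Finset.mem_erase.2 ⟨hrs, h1⟩
          rw [h2] at this
          simp at this
        simp [this, hrs]
      · simp [hs, hrs]
  · intro T _ hT
    simp [annihilation, hT]
  · simp

lemma expect_annihilation_mul_creation {L : ℕ} (N : ℕ) (r s : Fin L) :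
    expect N (annihilation r * creation s) = if r = s ∧ N ≤ r.val then 1 else 0 := by
  rw [expect_eq]
  set V := Finset.univ.filter fun r : Fin L => r.val < N with hV
  have hmem : ∀ t, t ∈ V ↔ t.val < N := by simp [hV]
  rw [Matrix.mul_apply, Finset.sum_eq_single (insert r V)]
  · simp only [creation, annihilation, Matrix.conjTranspose_apply, Matrix.of_apply]
    by_cases hr : r ∈ V
    · have h1 : ¬ N ≤ r.val := not_le.2 ((hmem r).1 hr)
      have h2 : ¬ (r ∈ insert r V ∧ V = (insert r V).erase r) := by
        rintro ⟨-, h⟩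
        rw [h] at hr
        simp at hr
      rw [if_neg h2, zero_mul, if_neg (fun h => h1 h.2)]
    · have h1 : N ≤ r.val := not_lt.1 (fun h => hr ((hmem r).2 h))
      by_cases hrs : r = s
      · subst hrs
        simp [hr, h1, ← mul_pow]
      · have h2 : ¬ (s ∈ insert r V ∧ V = (insert r V).erase s) := by
          rintro ⟨-, h⟩
          apply hr
          rw [h]
          simp [hrs]
        rw [if_neg h2]
        simp [hrs]
  · intro T _ hT
    have : ¬ (r ∈ T ∧ V = T.erase r) := by
      rintro ⟨h1, h2⟩
      exact hT (by rw [h2, Finset.insert_erase h1])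
    simp [annihilation, this]
  · simp

lemma expect_zero {L : ℕ} (N : ℕ) : expect N (0 : FockOp L) = 0 := by
  simp [expect_eq]

lemma expect_add {L : ℕ} (N : ℕ) (A B : FockOp L) :
    expect N (A + B) = expect N A + expect N B := by
  simp [expect_eq]

/-- The contraction is the anticommutator if `r` and `s` are both occupied, and 0 otherwise. -/
lemma expect_contraction_cre_ann {L : ℕ} (N : ℕ) (r s : Fin L) :
    expect N (contraction N (.cre r) (.ann s)) = if r = s then occupation N r else 0 := by
  unfold contraction normalOrderedPair occupation
  simp only [LadderOp.IsQuasiAnnihilation, LadderOp.toFock, not_le]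
  by_cases hrs : r = s
  · subst hrs
    by_cases hr : r.val < N
    · simp [hr, expect_add, expect_creation_mul_annihilation,
        expect_annihilation_mul_creation]
    · simp [hr, expect_eq]
  · split_ifs <;> simp [hrs, Ne.symm hrs, expect_zero, expect_add,
      expect_creation_mul_annihilation, expect_annihilation_mul_creation]

lemma expect_contraction_ann_cre {L : ℕ} (N : ℕ) (r s : Fin L) :
    expect N (contraction N (.ann r) (.cre s)) = if r = s then 1 - occupation N r else 0 := by
  unfold contraction normalOrderedPair occupation
  simp only [LadderOp.IsQuasiAnnihilation, LadderOp.toFock, not_lt]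
  by_cases hrs : r = s
  · subst hrs
    by_cases hr : r.val < N
    · simp [hr, hr.not_ge, expect_eq]
    · simp [hr, not_lt.1 hr, expect_add, expect_creation_mul_annihilation,
        expect_annihilation_mul_creation]
  · split_ifs <;> simp [hrs, Ne.symm hrs, expect_zero, expect_add,
      expect_creation_mul_annihilation, expect_annihilation_mul_creation]

end FermiDiagram

namespace FermiDiagram

/-! ### The value of a fully contracted chain -/

/-- The sign `(-1) ^ n` as a function of the parity of `n`. -/
noncomputable def paritySign (z : ZMod 2) : ℂ := (-1) ^ z.val

lemma paritySign_natCast (n : ℕ) : paritySign n = (-1) ^ n := by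
  rw [paritySign, ZMod.val_natCast, ← neg_one_pow_eq_pow_mod_two]

lemma paritySign_add (a b : ZMod 2) : paritySign (a + b) = paritySign a * paritySign b := by
  unfold paritySign
  rw [ZMod.val_add, ← neg_one_pow_eq_pow_mod_two, pow_add]

section Value

variable {L N m : ℕ} (C : Fin m → Block L N) (σ : FullContraction m)

/-- The product, over the contracted pairs in `S`, of the expectation values of the contractions. -/
noncomputable def contractionProd (S : Finset (Pos m)) : ℂ :=
  ∏ p ∈ S with p < σ.partner p, expect N (contraction N (opAt C p) (opAt C (σ.partner p)))

lemma takeOut_value {S : Finset (Pos m)} (hS : ∀ p ∈ S, σ.partner p ∈ S) {p : Pos m} (hp : p ∈ S)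
    (hlt : p < σ.partner p) :
    (-1) ^ (S.filter fun x => p < x ∧ x < σ.partner p).card
        * expect N (contraction N (opAt C p) (opAt C (σ.partner p)))
        * (paritySign (crossParity σ.partner ((S.erase p).erase (σ.partner p)))
          * contractionProd C σ ((S.erase p).erase (σ.partner p)))
      = paritySign (crossParity σ.partner S) * contractionProd C σ S := by
  have hcard : ((S.filter fun x => p < x ∧ x < σ.partner p).card : ZMod 2)
      = ∑ x ∈ S, inside σ.partner p x := by
    simp only [inside]
    rw [Finset.sum_boole]
  rw [crossParity_eq_erase_chord σ.partner_partner σ.partner_ne hS hp hlt, paritySign_add, ← hcard,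
    paritySign_natCast, contractionProd.eq_1 C σ S,
    filter_left_erase_chord σ.partner_partner hp hlt, Finset.prod_insert (by simp),
    contractionProd]
  ring

/-- The closed formula satisfies the recursion for every choice of the removed pair, whence
uniqueness; existence follows by removing pairs in one particular order. -/
lemma contractedValue_iff {S : Finset (Pos m)} (hS : ∀ p ∈ S, σ.partner p ∈ S) (v : ℂ) :
    ContractedValue C σ S v ↔
      v = paritySign (crossParity σ.partner S) * contractionProd C σ S := by
  constructor
  · intro h
    induction h with
    | empty => simp [crossParity, pairSum, contractionProd, paritySign]
    | takeOut S p q v hp hq hpq hσ h ih =>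
      subst hσ
      rw [ih (chord_erase_stable σ.partner_partner hS p), takeOut_value C σ hS hp hpq]
  · rintro rfl
    induction S using Finset.strongInduction with
    | H S ih =>
      rcases S.eq_empty_or_nonempty with rfl | hne
      · simpa [crossParity, pairSum, contractionProd, paritySign]
          using ContractedValue.empty (C := C) (σ := σ)
      -- The least remaining position is necessarily the left end of its pair.
      · have hmin := S.min'_mem hne
        set p := S.min' hne with hpdef
        have hlt : p < σ.partner p :=
          lt_of_le_of_ne (S.min'_le _ (hS p hmin)) (σ.partner_ne p).symm
        rw [← takeOut_value C σ hS hmin hlt]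
        refine .takeOut S p _ _ hmin (hS p hmin) hlt rfl
          (ih _ ?_ (chord_erase_stable σ.partner_partner hS p))
        exact (Finset.erase_subset _ _).trans_ssubset (Finset.erase_ssubset hmin)

lemma hasExpectation_iff (v : ℂ) :
    HasExpectation C σ v ↔
      v = paritySign (crossParity σ.partner Finset.univ) * contractionProd C σ Finset.univ :=
  contractedValue_iff C σ (fun _ _ => Finset.mem_univ _) v

end Value
end FermiDiagram

namespace FermiDiagram

/-! ### Intersections of semicircles -/

/-- The semicircle with end points `(a, y)` and `(b, y)`, bulging away from the horizontal axis. -/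
def semicircle (y a b : ℝ) : Set (ℝ × ℝ) :=
  {z | 0 ≤ y * (z.2 - y) ∧ (z.1 - a) * (z.1 - b) + (z.2 - y) ^ 2 = 0}

lemma semicircle_mem_Icc {y a b : ℝ} (hab : a < b) {z : ℝ × ℝ} (hz : z ∈ semicircle y a b) :
    a ≤ z.1 ∧ z.1 ≤ b := by
  have h := hz.2
  constructor <;> by_contra hlt <;> nlinarith [sq_nonneg (z.2 - y)]

lemma semicircle_inter_separate {y a b c d : ℝ} (hab : a < b) (hbc : b < c) (hcd : c < d) :
    semicircle y a b ∩ semicircle y c d = ∅ := by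
  refine Set.eq_empty_of_forall_notMem fun z hz => ?_
  linarith [(semicircle_mem_Icc hab hz.1).2, (semicircle_mem_Icc hcd hz.2).1]

/-- At a common point with abscissa `x`, `(x - a) * (b - x) = (x - c) * (d - x)`; but the difference
of the two sides is `(x - c) * (b - d) + (c - a) * (b - x) > 0`. -/
lemma semicircle_inter_nested {y a b c d : ℝ} (hac : a < c) (hcd : c < d) (hdb : d < b) :
    semicircle y a b ∩ semicircle y c d = ∅ := by
  refine Set.eq_empty_of_forall_notMem fun z hz => ?_
  obtain ⟨h1, h2⟩ := semicircle_mem_Icc hcd hz.2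
  have h3 := hz.1.2
  have h4 := hz.2.2
  nlinarith [mul_nonneg (sub_nonneg.2 h1) (sub_pos.2 hdb).le,
    mul_pos (sub_pos.2 hac) (lt_of_le_of_lt (sub_nonneg.2 h2) (sub_lt_sub_right hdb z.1))]

lemma semicircle_inter_interleaved {y a b c d : ℝ} (hy : y ^ 2 = 1) (hac : a < c) (hcb : c < b)
    (hbd : b < d) : (semicircle y a b ∩ semicircle y c d).ncard = 1 := by
  have hs : 0 < c + d - a - b := by linarith
  -- The radical axis: subtracting the two circle equations leaves a linear equation for the
  -- abscissa.
  set x := (c * d - a * b) / (c + d - a - b) with hx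
  have hxs : x * (c + d - a - b) = c * d - a * b := div_mul_cancel₀ _ hs.ne'
  have hxa : 0 < x - a := by
    have : x - a = (c - a) * (d - a) / (c + d - a - b) := by
      rw [eq_div_iff hs.ne', sub_mul, hxs]; ring
    rw [this]
    exact div_pos (mul_pos (by linarith) (by linarith)) hs
  have hxb : 0 < b - x := by
    have : b - x = (b - c) * (d - b) / (c + d - a - b) := by
      rw [eq_div_iff hs.ne', sub_mul, hxs]; ring
    rw [this]
    exact div_pos (mul_pos (by linarith) (by linarith)) hs
  set t := √((x - a) * (b - x)) with ht
  have ht2 : t ^ 2 = (x - a) * (b - x) := Real.sq_sqrt (mul_pos hxa hxb).le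
  have ht0 : 0 ≤ t := Real.sqrt_nonneg _
  rw [Set.ncard_eq_one]
  refine ⟨(x, y + y * t), Set.eq_singleton_iff_unique_mem.2 ⟨⟨⟨?_, ?_⟩, ⟨?_, ?_⟩⟩, ?_⟩⟩
  · have : y * (y + y * t - y) = y ^ 2 * t := by ring
    simp only [this, hy, one_mul, ht0]
  · have : (y + y * t - y) ^ 2 = y ^ 2 * t ^ 2 := by ring
    simp only [this, hy, ht2]
    ring
  · have : y * (y + y * t - y) = y ^ 2 * t := by ring
    simp only [this, hy, one_mul, ht0]
  · have : (y + y * t - y) ^ 2 = y ^ 2 * t ^ 2 := by ring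
    simp only [this, hy, ht2]
    linear_combination -hxs
  · rintro ⟨z1, z2⟩ ⟨⟨h1, h2⟩, ⟨-, h3⟩⟩
    simp only at h1 h2 h3
    have hz : z1 = x := by
      rw [hx, eq_div_iff hs.ne']
      linear_combination h2 - h3
    subst hz
    have hsq : (y * (z2 - y)) ^ 2 = t ^ 2 := by
      rw [mul_pow, hy, ht2]
      linear_combination h2
    have hyz : y * (z2 - y) = t := by
      rwa [sq_eq_sq₀ h1 ht0] at hsq
    have : z2 = y + y * t := by
      rw [← hyz]
      linear_combination (y - z2) * hy
    rw [this]

lemma semicircle_inter_opposite (a b c d : ℝ) :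
    semicircle 1 a b ∩ semicircle (-1) c d = ∅ := by
  refine Set.eq_empty_of_forall_notMem fun z hz => ?_
  have h1 := hz.1.1
  have h2 := hz.2.1
  linarith

lemma HalfPlane.ordinate_sq (h : HalfPlane) : h.ordinate ^ 2 = 1 := by
  cases h <;> simp [HalfPlane.ordinate]

/-! ### Crossings of a well-formed diagram -/

section Positions

variable {m : ℕ}

lemma leftPos_lt_rightPos (k : Fin m) : leftPos k < rightPos k := by
  rw [Prod.Lex.lt_iff]
  exact Or.inr ⟨rfl, by simp [leftPos, rightPos]⟩

lemma eq_leftPos_or_eq_rightPos (p : Pos m) : p = leftPos p.block ∨ p = rightPos p.block := by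
  obtain ⟨k, i⟩ := p
  fin_cases i
  · exact Or.inl rfl
  · exact Or.inr rfl

lemma Pos.forall_iff {P : Pos m → Prop} :
    (∀ p, P p) ↔ ∀ k, P (leftPos k) ∧ P (rightPos k) := by
  refine ⟨fun h k => ⟨h _, h _⟩, fun h p => ?_⟩
  rcases eq_leftPos_or_eq_rightPos p with hp | hp <;> rw [hp]
  · exact (h _).1
  · exact (h _).2

lemma Pos.sum_eq {R : Type*} [AddCommMonoid R] (f : Pos m → R) :
    ∑ p, f p = ∑ k, (f (leftPos k) + f (rightPos k)) := by
  rw [← Equiv.sum_comp (toLex : Fin m × Fin 2 ≃ Pos m) f, Fintype.sum_prod_type]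
  simp only [Fin.sum_univ_two]
  rfl

lemma Pos.lt_iff {p q : Pos m} :
    p < q ↔ p.block < q.block ∨ ∃ k, p = leftPos k ∧ q = rightPos k := by
  constructor
  · intro h
    rcases Prod.Lex.lt_iff.1 h with h | ⟨h1, h2⟩
    · exact Or.inl h
    · refine Or.inr ⟨p.block, ?_⟩
      obtain ⟨k, i⟩ := p
      obtain ⟨l, j⟩ := q
      change k = l at h1
      subst h1
      change i < j at h2
      have hi : i = 0 := by omega
      have hj : j = 1 := by omega
      subst hi hj
      exact ⟨rfl, rfl⟩
  · rintro (h | ⟨k, rfl, rfl⟩)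
    · exact Prod.Lex.lt_iff.2 (Or.inl h)
    · exact leftPos_lt_rightPos k

@[simp] lemma block_leftPos (k : Fin m) : (leftPos k).block = k := rfl

@[simp] lemma block_rightPos (k : Fin m) : (rightPos k).block = k := rfl

lemma leftPos_lt_leftPos {k l : Fin m} : leftPos k < leftPos l ↔ k < l := by
  rw [Pos.lt_iff]
  refine ⟨?_, Or.inl⟩
  rintro (h | ⟨j, h1, h2⟩)
  · exact h
  · exact absurd (congrArg (fun p => (ofLex p).2) h2) (by simp [leftPos, rightPos])

lemma rightPos_lt_rightPos {k l : Fin m} : rightPos k < rightPos l ↔ k < l := by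
  rw [Pos.lt_iff]
  refine ⟨?_, Or.inl⟩
  rintro (h | ⟨j, h1, h2⟩)
  · exact h
  · exact absurd (congrArg (fun p => (ofLex p).2) h1) (by simp [leftPos, rightPos])

lemma rightPos_lt_leftPos {k l : Fin m} : rightPos k < leftPos l ↔ k < l := by
  rw [Pos.lt_iff]
  refine ⟨?_, Or.inl⟩
  rintro (h | ⟨j, h1, h2⟩)
  · exact h
  · exact absurd (congrArg (fun p => (ofLex p).2) h1) (by simp [leftPos, rightPos])

lemma leftPos_lt_rightPos_iff {k l : Fin m} : leftPos k < rightPos l ↔ k < l ∨ k = l := by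
  rw [Pos.lt_iff]
  refine or_congr Iff.rfl ⟨?_, ?_⟩
  · rintro ⟨j, h1, h2⟩
    exact (congrArg Pos.block h1).trans (congrArg Pos.block h2).symm
  · rintro rfl
    exact ⟨k, rfl, rfl⟩

end Positions

lemma abscissa_bounds {L N m : ℕ} (C : Fin m → Block L N) (p : Pos m) :
    (p.block.val : ℝ) - 1 / 4 ≤ abscissa C p ∧ abscissa C p ≤ p.block.val + 1 / 4 := by
  unfold abscissa
  split
  · split_ifs <;> constructor <;> linarith
  · constructor <;> linarith

namespace Diagram

variable {L N m : ℕ} {C : Fin m → Block L N} {σ : FullContraction m} (D : Diagram C σ)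

/-- Different blocks stay at least `1 / 2` apart. Within a bracket the abscissas coincide, but there
the half-planes differ. -/
lemma abscissa_lt {p q : Pos m} (hpq : p < q) (hhalf : D.half p = D.half q) :
    abscissa C p < abscissa C q := by
  rcases Pos.lt_iff.1 hpq with h | ⟨k, rfl, rfl⟩
  · have h1 := (abscissa_bounds C p).2
    have h2 := (abscissa_bounds C q).1
    have h3 : (p.block.val : ℝ) + 1 ≤ q.block.val := by exact_mod_cast h
    linarith
  · unfold abscissa
    rw [block_leftPos, block_rightPos]
    cases hk : C k with
    | deexc i a =>
      obtain ⟨h1, h2, -⟩ := D.opening k i a hk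
      rw [h1, h2] at hhalf
      cases hhalf
    | exc b j =>
      obtain ⟨h1, h2, -⟩ := D.closing k b j hk
      rw [h1, h2] at hhalf
      cases hhalf
    | pair r s =>
      simp [leftPos, rightPos]
      norm_num

variable {D}

lemma WellFormed.line_eq (hD : D.WellFormed) (p : Pos m) :
    D.line p = semicircle (D.half p).ordinate (abscissa C p) (abscissa C (σ.partner p)) := by
  simp [line, semicircle, ← hD.P1 p]

lemma WellFormed.ncard_line_inter (hD : D.WellFormed) {p q : Pos m} (hp : p < σ.partner p)
    (hq : q < σ.partner q) (hpq : p < q) :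
    ((D.line p ∩ D.line q).ncard : ZMod 2)
      = if (D.half p = .upper ↔ D.half q = .upper) then chordCross σ.partner p q else 0 := by
  rw [hD.line_eq, hD.line_eq]
  have hPp := hD.P1 p
  have hPq := hD.P1 q
  have h1 : σ.partner p ≠ q := by
    rintro rfl
    rw [σ.partner_partner] at hq
    exact lt_asymm hp hq
  have h3 : σ.partner p ≠ σ.partner q := fun h =>
    hpq.ne (by rw [← σ.partner_partner p, h, σ.partner_partner])
  by_cases hh : D.half p = D.half q
  · have e1 := D.abscissa_lt hp hPp
    have e2 := D.abscissa_lt hq hPq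
    have e3 := D.abscissa_lt hpq hh
    rw [if_pos (by rw [hh]), ← hh]
    unfold chordCross inside
    rcases h1.lt_or_gt with h | h
    · rw [semicircle_inter_separate e1 (D.abscissa_lt h (by rw [← hPp, hh])) e2]
      simp [h.not_gt, (h.trans hq).not_gt]
    · have e4 := D.abscissa_lt h (by rw [← hPp, hh])
      rcases h3.lt_or_gt with h' | h'
      · rw [semicircle_inter_interleaved (D.half p).ordinate_sq e3 e4
          (D.abscissa_lt h' (by rw [← hPp, ← hPq, hh]))]
        simp [h, h'.not_gt, hpq]
      · rw [semicircle_inter_nested e3 e2 (D.abscissa_lt h' (by rw [← hPp, ← hPq, hh]))]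
        -- Nested chords: both end points of the inner one are counted.
        have h2 : (0 : ZMod 2) = 1 + 1 := rfl
        simp [h, h', hpq, hpq.trans hq, h2]
  · cases ep : D.half p <;> cases eq : D.half q <;> simp [ep, eq] at hh ⊢
    · simp [HalfPlane.ordinate, semicircle_inter_opposite]
    · rw [Set.inter_comm]
      simp [HalfPlane.ordinate, semicircle_inter_opposite]

lemma WellFormed.natCast_crossings (hD : D.WellFormed) :
    (D.crossings : ZMod 2) = pairSum (Finset.univ.filter fun p => p < σ.partner p)
      (fun p q => if (D.half p = .upper ↔ D.half q = .upper) then chordCross σ.partner p q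
        else 0) := by
  unfold crossings pairSum
  push_cast
  refine Finset.sum_congr rfl fun p hp => ?_
  rw [← Finset.sum_filter, Finset.filter_filter]
  refine Finset.sum_congr rfl fun q hq => ?_
  simp only [Finset.mem_filter, Finset.mem_univ, true_and] at hp hq
  exact hD.ncard_line_inter hp hq.1 hq.2

end Diagram
end FermiDiagram

/-! ### Parity of the crossings between upper and lower chords -/

namespace FermiDiagram

/-- Stated over `ℤ` because the parity of the pair sum is found by halving this identity, which is
impossible modulo 2. -/
lemma sum_sq_add_two_mul_pairSum {α : Type*} [LinearOrder α] (B : Finset α) (c : α → ℤ) :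
    ∑ k ∈ B, c k ^ 2 + 2 * pairSum B (fun k l => c k * c l) = (∑ k ∈ B, c k) ^ 2 := by
  induction B using Finset.induction_on with
  | empty => simp [pairSum]
  | insert p B hp ih =>
    rw [pairSum_insert hp (fun b _ => mul_comm _ _), Finset.sum_insert hp, Finset.sum_insert hp,
      ← Finset.mul_sum, add_sq, ← ih]
    ring

namespace Diagram

variable {L N m : ℕ} {C : Fin m → Block L N} {σ : FullContraction m} {D : Diagram C σ}

/-- Brackets satisfy this by convention. The four shapes in P3 are exactly those for which a dash
satisfies both this and `half_rightPos`. -/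
lemma WellFormed.half_leftPos (hD : D.WellFormed) (k : Fin m) :
    D.half (leftPos k) = .upper ↔ D.dir (leftPos k) = .right := by
  cases hk : C k with
  | deexc i a => simp [D.opening k i a hk]
  | exc b j => simp [D.closing k b j hk]
  | pair r s =>
    have h := hD.P3 k (by rw [hk]; trivial)
    simp only [Set.mem_insert_iff, Set.mem_singleton_iff, Prod.mk.injEq] at h
    rcases h with h | h | h | h <;> simp [h]

lemma WellFormed.half_rightPos (hD : D.WellFormed) (k : Fin m) :
    D.half (rightPos k) = .upper ↔ D.dir (rightPos k) = .left := by
  cases hk : C k with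
  | deexc i a => simp [D.opening k i a hk]
  | exc b j => simp [D.closing k b j hk]
  | pair r s =>
    have h := hD.P3 k (by rw [hk]; trivial)
    simp only [Set.mem_insert_iff, Set.mem_singleton_iff, Prod.mk.injEq] at h
    rcases h with h | h | h | h <;> simp [h]

lemma WellFormed.dir_of_lt (hD : D.WellFormed) {p : Pos m} (hp : p < σ.partner p) :
    D.dir p = .right ∧ D.dir (σ.partner p) = .left :=
  hD.P2 p (D.abscissa_lt hp (hD.P1 p))

/-- As many left as right extremities are in the upper half-plane. -/
lemma WellFormed.sum_upper_left_eq (hD : D.WellFormed) :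
    ∑ k, (if D.half (leftPos k) = .upper then (1 : ℤ) else 0)
      = ∑ k, (if D.half (rightPos k) = .upper then (1 : ℤ) else 0) := by
  have h0 : ∑ p, (if D.dir p = .right then (1 : ℤ) else -1) = 0 := by
    rw [sum_eq_sum_chords σ.partner_partner σ.partner_ne (fun _ _ => Finset.mem_univ _)]
    refine Finset.sum_eq_zero fun p hp => ?_
    obtain ⟨h1, h2⟩ := hD.dir_of_lt (Finset.mem_filter.1 hp).2
    simp [h1, h2]
  rw [Pos.sum_eq] at h0
  have h1 : ∀ k, (if D.dir (leftPos k) = .right then (1 : ℤ) else -1)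
      + (if D.dir (rightPos k) = .right then (1 : ℤ) else -1)
      = 2 * ((if D.half (leftPos k) = .upper then (1 : ℤ) else 0)
        - (if D.half (rightPos k) = .upper then (1 : ℤ) else 0)) := by
    intro k
    simp only [hD.half_leftPos, hD.half_rightPos]
    cases D.dir (leftPos k) <;> cases D.dir (rightPos k) <;> simp
  simp only [h1] at h0
  rw [← Finset.mul_sum, Finset.sum_sub_distrib] at h0
  linarith

/-- The number of pairs of an upper extremity to the left of a lower one is even. -/
lemma WellFormed.even_upper_before_lower (hD : D.WellFormed) :
    Even (∑ x, ∑ u, if ¬ D.half x = .upper ∧ D.half u = .upper ∧ u < x then (1 : ℤ) else 0) := by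
  set a : Fin m → ℤ := fun k => if D.half (leftPos k) = .upper then 1 else 0 with ha
  set b : Fin m → ℤ := fun k => if D.half (rightPos k) = .upper then 1 else 0 with hb
  have hab : ∑ k, a k = ∑ k, b k := hD.sum_upper_left_eq
  have hsq := sum_sq_add_two_mul_pairSum Finset.univ (fun k => a k + b k)
  have ha2 : ∀ k, a k ^ 2 = a k := by intro k; simp only [ha]; split_ifs <;> norm_num
  have hb2 : ∀ k, b k ^ 2 = b k := by intro k; simp only [hb]; split_ifs <;> norm_num
  -- Count by blocks: for `k < l`, upper extremities of `k` times lower ones of `l`; inside one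
  -- block, only left up and right down contributes.
  have hE : (∑ x, ∑ u, if ¬ D.half x = .upper ∧ D.half u = .upper ∧ u < x then (1 : ℤ) else 0)
      = pairSum Finset.univ (fun k l => (a k + b k) * (2 - a l - b l))
        + ∑ k, a k * (1 - b k) := by
    have hdiag : ∑ k, a k * (1 - b k)
        = ∑ l, ∑ k, if k = l then a k * (1 - b l) else 0 := by
      simp
    rw [Pos.sum_eq, hdiag, pairSum, Finset.sum_comm, ← Finset.sum_add_distrib]
    refine Finset.sum_congr rfl fun l _ => ?_
    rw [Pos.sum_eq, Pos.sum_eq, ← Finset.sum_add_distrib, ← Finset.sum_add_distrib]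
    refine Finset.sum_congr rfl fun k _ => ?_
    simp only [leftPos_lt_leftPos, rightPos_lt_leftPos, leftPos_lt_rightPos_iff,
      rightPos_lt_rightPos, ha, hb]
    rcases lt_trichotomy k l with h | h | h
    · by_cases h1 : D.half (leftPos k) = .upper <;> by_cases h2 : D.half (rightPos k) = .upper <;>
        by_cases h3 : D.half (leftPos l) = .upper <;>
        by_cases h4 : D.half (rightPos l) = .upper <;> simp [h, h.ne, h1, h2, h3, h4]
    · subst h
      by_cases h1 : D.half (leftPos k) = .upper <;>
        by_cases h2 : D.half (rightPos k) = .upper <;> simp [h1, h2]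
    · simp [h.not_gt, h.ne']
  have hsplit : pairSum Finset.univ (fun k l => (a k + b k) * (2 - a l - b l))
      = 2 * pairSum Finset.univ (fun k _ => a k + b k)
        - pairSum Finset.univ (fun k l => (a k + b k) * (a l + b l)) := by
    simp only [pairSum, Finset.mul_sum, ← Finset.sum_sub_distrib]
    refine Finset.sum_congr rfl fun k _ => Finset.sum_congr rfl fun l _ => ?_
    split_ifs <;> ring
  have hsum2 : ∑ k, (a k + b k) ^ 2 = 2 * ∑ k, a k + 2 * ∑ k, a k * b k := by
    simp only [add_sq, ha2, hb2, Finset.sum_add_distrib, ← hab, mul_assoc, ← Finset.mul_sum]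
    ring
  have hsum1 : ∑ k, a k * (1 - b k) = ∑ k, a k - ∑ k, a k * b k := by
    simp only [mul_sub, mul_one, Finset.sum_sub_distrib]
  rw [hsum2, Finset.sum_add_distrib, ← hab] at hsq
  rw [hE, hsplit, hsum1]
  -- With `A = ∑ a = ∑ b` and `Q = ∑ a b`, halving `hsq` gives `2 A ^ 2 - A - Q` for the pair sum of
  -- the products; subtracting it and adding the diagonal `A - Q` cancels `Q` and leaves an even
  -- number.
  refine ⟨pairSum Finset.univ (fun k _ => a k + b k) - (∑ k, a k) ^ 2 + ∑ k, a k, ?_⟩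
  linarith

/-- The parity of the number of crossings in the diagram is that of the number of crossings of
the contraction lines drawn on one side of the chain. -/
lemma WellFormed.crossParity_eq (hD : D.WellFormed) :
    crossParity σ.partner Finset.univ = (D.crossings : ZMod 2) := by
  have hsym : ∀ p ∈ Finset.univ.filter (fun p => p < σ.partner p),
      ∀ q ∈ Finset.univ.filter (fun p => p < σ.partner p),
      p ≠ q → chordCross σ.partner p q = chordCross σ.partner q p := fun p hp q hq hpq =>
    chordCross_symm σ.partner_partner (Finset.mem_filter.1 hp).2 (Finset.mem_filter.1 hq).2 hpq
  have hmixed := pairSum_bipartite (Finset.univ.filter fun p => p < σ.partner p)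
    (fun p => D.half p = .upper) hsym
  rw [sum_mixed_crossings σ.partner_partner σ.partner_ne (fun p => D.half p = .upper)
    (fun p => by rw [← hD.P1 p])] at hmixed
  have heven : (∑ x, ∑ u, if ¬ D.half x = .upper ∧ D.half u = .upper ∧ u < x then
      (1 : ZMod 2) else 0) = 0 := by
    have h := (ZMod.intCast_zmod_eq_zero_iff_dvd _ 2).2
      (even_iff_two_dvd.1 hD.even_upper_before_lower)
    push_cast at h
    exact h
  refine Eq.trans ?_ (add_zero (D.crossings : ZMod 2))
  rw [← hmixed.trans heven, hD.natCast_crossings, ← pairSum_add]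
  refine pairSum_congr fun p _ q _ _ => ?_
  split_ifs <;> simp

end Diagram
end FermiDiagram

namespace FermiDiagram

/-! ### Occupation factors -/

namespace Diagram

variable {L N m : ℕ} {C : Fin m → Block L N} {σ : FullContraction m} (D : Diagram C σ)

/-- The occupation factor of an extremity: `n` in the upper and `1 - n` in the lower half-plane. -/
noncomputable def weight (p : Pos m) : ℂ :=
  if D.half p = .upper then occupation N (opAt C p).orbital
  else 1 - occupation N (opAt C p).orbital

/-- Occupation numbers are 0 or 1. Thus the single factor of a contraction can be shared by both
ends of its connection. -/
lemma weight_mul_self (p : Pos m) : D.weight p * D.weight p = D.weight p := by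
  unfold weight occupation
  split_ifs <;> simp

lemma opAt_leftPos (k : Fin m) : opAt C (leftPos k) = (C k).first := rfl

lemma opAt_rightPos (k : Fin m) : opAt C (rightPos k) = (C k).second := rfl

lemma weight_eq_one {p : Pos m} (hp : ¬ (C p.block).IsPair) : D.weight p = 1 := by
  revert p
  rw [Pos.forall_iff]
  intro k
  simp only [block_leftPos, block_rightPos, weight, opAt_leftPos, opAt_rightPos]
  cases hk : C k with
  | deexc i a =>
    obtain ⟨h1, h2, -⟩ := D.opening k i a hk
    simp [h1, h2, Block.first, Block.second, LadderOp.orbital, occupation, i.2, a.2.not_gt]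
  | exc b j =>
    obtain ⟨h1, h2, -⟩ := D.closing k b j hk
    simp [h1, h2, Block.first, Block.second, LadderOp.orbital, occupation, j.2, b.2.not_gt]
  | pair r s => simp [Block.IsPair]

/-- Extending the product to the brackets, where the factors are 1, allows it to be regrouped by
connections. -/
lemma dashOccupation_eq : D.dashOccupation = ∏ p, D.weight p := by
  classical
  unfold dashOccupation
  rw [Finset.prod_filter]
  refine Finset.prod_congr rfl fun p _ => ?_
  split_ifs with h h'
  · simp [weight, h']
  · simp [weight, h']
  · exact (D.weight_eq_one h).symm

variable {D}

lemma opAt_leftPos_eq_cre (k : Fin m) :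
    opAt C (leftPos k) = .cre (opAt C (leftPos k)).orbital := by
  rw [opAt_leftPos]
  cases C k <;> rfl

lemma opAt_rightPos_eq_ann (k : Fin m) :
    opAt C (rightPos k) = .ann (opAt C (rightPos k)).orbital := by
  rw [opAt_rightPos]
  cases C k <;> rfl

/-- The extremities in the upper half-plane that point to the right and those in the lower
half-plane that point to the left carry creation operators, the others annihilation operators. -/
lemma WellFormed.opAt_eq (hD : D.WellFormed) (p : Pos m) :
    opAt C p = if (D.half p = .upper ↔ D.dir p = .right) then .cre (opAt C p).orbital
      else .ann (opAt C p).orbital := by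
  revert p
  rw [Pos.forall_iff]
  intro k
  rw [if_pos (hD.half_leftPos k), if_neg]
  · exact ⟨opAt_leftPos_eq_cre k, opAt_rightPos_eq_ann k⟩
  · rw [hD.half_rightPos k]
    cases D.dir (rightPos k) <;> simp

lemma WellFormed.weight_partner (hD : D.WellFormed) {p : Pos m}
    (h : (opAt C p).orbital = (opAt C (σ.partner p)).orbital) :
    D.weight (σ.partner p) = D.weight p := by
  unfold weight
  rw [← hD.P1 p, h]

/-- The directions imposed by P2 and the common half-plane fix the operator types through `opAt_eq`:
creation first above, annihilation first below. -/
lemma WellFormed.expect_contraction (hD : D.WellFormed) {p : Pos m} (hp : p < σ.partner p) :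
    expect N (contraction N (opAt C p) (opAt C (σ.partner p)))
      = (if (opAt C p).orbital = (opAt C (σ.partner p)).orbital then 1 else 0)
        * (D.weight p * D.weight (σ.partner p)) := by
  obtain ⟨h1, h2⟩ := hD.dir_of_lt hp
  have e1 := hD.opAt_eq p
  have e2 := hD.opAt_eq (σ.partner p)
  rw [h1] at e1
  rw [h2, ← hD.P1 p] at e2
  by_cases horb : (opAt C p).orbital = (opAt C (σ.partner p)).orbital
  · rw [if_pos horb, one_mul, hD.weight_partner horb, weight_mul_self]
    rw [e1, e2]
    cases hh : D.half p <;>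
      simp [weight, hh, expect_contraction_cre_ann, expect_contraction_ann_cre, horb]
  · rw [if_neg horb, zero_mul, e1, e2]
    cases hh : D.half p <;>
      simp [expect_contraction_cre_ann, expect_contraction_ann_cre, horb]

lemma WellFormed.contractionProd_eq (hD : D.WellFormed) :
    contractionProd C σ Finset.univ = D.deltas * D.dashOccupation := by
  have h : ∏ p, D.weight p
      = ∏ p with p < σ.partner p, (D.weight p * D.weight (σ.partner p)) :=
    -- The product over `ℂ` is read as a sum in `Additive ℂ`.
    sum_eq_sum_chords (R := Additive ℂ) σ.partner_partner σ.partner_ne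
      (fun _ _ => Finset.mem_univ _) (fun p => Additive.ofMul (D.weight p))
  rw [dashOccupation_eq, h, deltas, ← Finset.prod_mul_distrib]
  exact Finset.prod_congr rfl fun p hp => hD.expect_contraction (Finset.mem_filter.1 hp).2

/-- If all Kronecker deltas are `1`, then so is every occupation factor, unless the two extremities
of the dash are connected to each other and the left one points at a virtual spin-orbital. -/
lemma WellFormed.weight_eq_one_of_deltas (hD : D.WellFormed) (hC : AtMostOnePair C)
    (hdash : ∀ k r s, C k = .pair r s → σ.partner (leftPos k) = rightPos k → r.val < N)
    (hδ : ∀ p, (opAt C p).orbital = (opAt C (σ.partner p)).orbital) (p : Pos m) :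
    D.weight p = 1 := by
  by_cases hp : (C p.block).IsPair
  swap
  · exact D.weight_eq_one hp
  by_cases hq : (C (σ.partner p).block).IsPair
  swap
  -- The partner is a bracket extremity in the same half-plane with the same spin-orbital, so its
  -- factor 1 carries over.
  · rw [← hD.weight_partner (hδ p), D.weight_eq_one hq]
  have hblock : (σ.partner p).block = p.block := hC _ _ hq hp
  have hne := σ.partner_ne p
  obtain ⟨k, hk⟩ : ∃ k, k = p.block := ⟨_, rfl⟩
  have hself : σ.partner (leftPos k) = rightPos k := by
    rcases eq_leftPos_or_eq_rightPos p with h1 | h1 <;>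
      rcases eq_leftPos_or_eq_rightPos (σ.partner p) with h2 | h2 <;>
      rw [hblock, ← hk] at h2 <;> rw [← hk] at h1
    · exact absurd (h2.trans h1.symm) hne
    · rw [← h1, h2]
    · rw [← h2, σ.partner_partner, h1]
    · exact absurd (h2.trans h1.symm) hne
  have hleft : D.weight (leftPos k) = 1 := by
    -- As the left end of its connection this extremity points right, which for a left operator
    -- means up; so its factor is `n_r`.
    have hup : D.half (leftPos k) = .upper :=
      (hD.half_leftPos k).2 (hD.dir_of_lt (hself ▸ leftPos_lt_rightPos k)).1
    rw [← hk] at hp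
    cases hCk : C k with
    | deexc i a => rw [hCk] at hp; exact hp.elim
    | exc b j => rw [hCk] at hp; exact hp.elim
    | pair r s =>
      have hr := hdash k r s hCk hself
      simp [weight, hup, opAt_leftPos, hCk, Block.first, LadderOp.orbital, occupation, hr]
  rcases eq_leftPos_or_eq_rightPos p with h1 | h1 <;> rw [h1, ← hk]
  · exact hleft
  · rw [← hself, hD.weight_partner (hδ _), hleft]

lemma WellFormed.deltas_mul_dashOccupation (hD : D.WellFormed) (hC : AtMostOnePair C)
    (hdash : ∀ k r s, C k = .pair r s → σ.partner (leftPos k) = rightPos k → r.val < N) :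
    D.deltas * D.dashOccupation = D.deltas := by
  by_cases h0 : D.deltas = 0
  · rw [h0, zero_mul]
  have hleft : ∀ p, p < σ.partner p → (opAt C p).orbital = (opAt C (σ.partner p)).orbital := by
    intro p hp
    by_contra hne
    exact h0 (Finset.prod_eq_zero (Finset.mem_filter.2 ⟨Finset.mem_univ p, hp⟩) (if_neg hne))
  have hδ : ∀ p, (opAt C p).orbital = (opAt C (σ.partner p)).orbital := by
    intro p
    rcases (σ.partner_ne p).lt_or_gt with h | h
    · have := hleft (σ.partner p) (by rwa [σ.partner_partner])
      rw [σ.partner_partner] at this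
      exact this.symm
    · exact hleft p h
  rw [dashOccupation_eq,
    Finset.prod_eq_one fun p _ => hD.weight_eq_one_of_deltas hC hdash hδ p, mul_one]

end Diagram
end FermiDiagram

open FermiDiagram
theorem mainTheorem1 (L N : ℕ) (hN : N ≤ L) (m : ℕ) (C : Fin m → Block L N)
    (hC : AtMostOnePair C) (σ : FullContraction m) (D : Diagram C σ) (hD : D.WellFormed) :
    (∀ v : ℂ, HasExpectation C σ v ↔ v = (-1) ^ D.crossings * D.deltas * D.dashOccupation) ∧
    ((∀ k r s, C k = .pair r s → σ.partner (leftPos k) = rightPos k → r.val < N) →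
      ∀ v : ℂ, HasExpectation C σ v ↔ v = (-1) ^ D.crossings * D.deltas) := by
  have key : ∀ v : ℂ,
      HasExpectation C σ v ↔ v = (-1) ^ D.crossings * (D.deltas * D.dashOccupation) := by
    intro v
    rw [hasExpectation_iff, hD.crossParity_eq, paritySign_natCast, hD.contractionProd_eq]
  refine ⟨fun v => by rw [key, mul_assoc], fun hdash v => ?_⟩
  rw [key, hD.deltas_mul_dashOccupation hC hdash]
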